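/- Let $\mathcal{L}^{2-}$ be the set of first-order formulas that use only two variables $x,y$, only unary or binary predicates, no individual constants or function symbols, no equality and no counting quantifiers. A positive conjunctive query is a formula $\psi(\bar y)$ of the form $\exists \bar x\,(\alpha_1(\bar x,\bar y)\wedge\cdots\wedge\alpha_n(\bar x,\bar y))$ with $n\ge 1$, where each $\alpha_i$ is an atom with a unary or binary predicate other than equality, all of whose arguments are variables among $\bar x,\bar y$ (the tuples $\bar x$ and $\bar y$ may be empty). For a sentence $\varphi$ and a positive conjunctive query $\psi(\bar y)$, let $\mathcal{Q}_{\varphi,\psi(\bar y)}$ be the problem: given a finite set $\Delta$ of ground, function-free literals and a tuple $\bar a$ of individual constants of the same arity as $\bar y$, does $\Delta\cup\{\varphi\}$ entail $\psi(\bar a)$? Let $\mathcal{FQ}_{\varphi,\psi(\bar y)}$ be the problem: given $\Delta$ and $\bar a$ as before, is $\psi(\bar a)$ true in every finite model of $\Delta\cup\{\varphi\}$? Theorem. There exist an $\mathcal{L}^{2-}$-sentence $\varphi'$ and a positive conjunctive query $\psi(\bar y)$ such that $\mathcal{Q}_{\varphi',\psi(\bar y)}$ is undecidable. Likewise, there exist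 an $\mathcal{L}^{2-}$-sentence $\varphi'$ and a positive conjunctive query $\psi(\bar y)$ such that $\mathcal{FQ}_{\varphi',\psi(\bar y)}$ is undecidable. -/

import Mathlib

namespace DataComplexity

universe u

/-- Equality-free or equality atoms whose arguments are taken from `V` (variables, or individual
constants). The predicate symbols of arity `k` are the pairs consisting of a name in `ℕ` and `k`;
the arity of an occurrence is the length of its argument list. -/
inductive Atom (V : Type) : Type
  | rel (p : ℕ) (args : List V) : Atom V
  | eq (s t : V) : Atom V

/-- Atoms as plain data. -/
def Atom.equivSum (V : Type) : Atom V ≃ (ℕ × List V) ⊕ (V × V) where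
  toFun
    | .rel p args => .inl (p, args)
    | .eq s t => .inr (s, t)
  invFun
    | .inl (p, args) => .rel p args
    | .inr (s, t) => .eq s t
  left_inv a := by cases a <;> rfl
  right_inv a := by rcases a with ⟨p, args⟩ | ⟨s, t⟩ <;> rfl

/-- The standard effective coding of atoms. -/
instance (V : Type) [Primcodable V] : Primcodable (Atom V) :=
  Primcodable.ofEquiv _ (Atom.equivSum V)

/-- The atom is not an equality, and its predicate is unary or binary. -/
def Atom.IsUnaryOrBinary {V : Type} : Atom V → Prop
  | .rel _ args => args.length = 1 ∨ args.length = 2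
  | .eq _ _ => False

/-- The variables occurring in an atom. -/
def Atom.vars {V : Type} : Atom V → Set V
  | .rel _ args => {v | v ∈ args}
  | .eq s t => {s, t}

/-- A structure with domain `D`: it interprets the individual constants (named by `ℕ`) and, for
every `k`, the predicate symbols of arity `k` (named by `ℕ`). Distinct constants may denote the
same element. The domain is nonempty, since constants are interpreted in it. -/
structure Interp (D : Type u) where
  const : ℕ → D
  rel : (k : ℕ) → ℕ → (Fin k → D) → Prop

/-- Truth of an atom when its arguments denote according to `e`. -/
def Atom.Holds {D : Type u} {V : Type} (I : Interp D) (e : V → D) : Atom V → Prop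
  | .rel p args => I.rel args.length p (fun i => e (args.get i))
  | .eq s t => e s = e t

/-- First-order formulas with counting quantifiers, over a purely relational signature with
equality, with variables from `V`. -/
inductive Formula (V : Type) : Type
  | atom (a : Atom V) : Formula V
  | neg (f : Formula V) : Formula V
  | and (f g : Formula V) : Formula V
  | or (f g : Formula V) : Formula V
  | imp (f g : Formula V) : Formula V
  | iff (f g : Formula V) : Formula V
  | all (v : V) (f : Formula V) : Formula V
  | ex (v : V) (f : Formula V) : Formula V
  | exLE (C : ℕ) (v : V) (f : Formula V) : Formula V
  | exGE (C : ℕ) (v : V) (f : Formula V) : Formula V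
  | exEq (C : ℕ) (v : V) (f : Formula V) : Formula V

namespace Formula

/-- Truth of a formula in a structure under an assignment. -/
def Holds {D : Type u} {V : Type} [DecidableEq V] (I : Interp D) : Formula V → (V → D) → Prop
  | atom a, e => a.Holds I e
  | neg f, e => ¬ f.Holds I e
  | and f g, e => f.Holds I e ∧ g.Holds I e
  | or f g, e => f.Holds I e ∨ g.Holds I e
  | imp f g, e => f.Holds I e → g.Holds I e
  | iff f g, e => (f.Holds I e ↔ g.Holds I e)
  | all v f, e => ∀ d : D, f.Holds I (Function.update e v d)
  | ex v f, e => ∃ d : D, f.Holds I (Function.update e v d)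
  | exLE C v f, e => {d : D | f.Holds I (Function.update e v d)}.encard ≤ C
  | exGE C v f, e => (C : ℕ∞) ≤ {d : D | f.Holds I (Function.update e v d)}.encard
  | exEq C v f, e => {d : D | f.Holds I (Function.update e v d)}.encard = C

/-- The free variables of a formula. -/
def freeVars {V : Type} : Formula V → Set V
  | atom a => a.vars
  | neg f => f.freeVars
  | and f g => f.freeVars ∪ g.freeVars
  | or f g => f.freeVars ∪ g.freeVars
  | imp f g => f.freeVars ∪ g.freeVars
  | iff f g => f.freeVars ∪ g.freeVars
  | all v f => f.freeVars \ {v}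
  | ex v f => f.freeVars \ {v}
  | exLE _ v f => f.freeVars \ {v}
  | exGE _ v f => f.freeVars \ {v}
  | exEq _ v f => f.freeVars \ {v}

/-- A sentence is a formula without free variables. -/
def IsSentence {V : Type} (f : Formula V) : Prop := f.freeVars = ∅

/-- Every atom of the formula satisfies `P`. -/
def AllAtoms {V : Type} (P : Atom V → Prop) : Formula V → Prop
  | atom a => P a
  | neg f => f.AllAtoms P
  | and f g => f.AllAtoms P ∧ g.AllAtoms P
  | or f g => f.AllAtoms P ∧ g.AllAtoms P
  | imp f g => f.AllAtoms P ∧ g.AllAtoms P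
  | iff f g => f.AllAtoms P ∧ g.AllAtoms P
  | all _ f => f.AllAtoms P
  | ex _ f => f.AllAtoms P
  | exLE _ _ f => f.AllAtoms P
  | exGE _ _ f => f.AllAtoms P
  | exEq _ _ f => f.AllAtoms P

/-- No counting quantifier occurs in the formula. -/
def CountingFree {V : Type} : Formula V → Prop
  | atom _ => True
  | neg f => f.CountingFree
  | and f g => f.CountingFree ∧ g.CountingFree
  | or f g => f.CountingFree ∧ g.CountingFree
  | imp f g => f.CountingFree ∧ g.CountingFree
  | iff f g => f.CountingFree ∧ g.CountingFree
  | all _ f => f.CountingFree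
  | ex _ f => f.CountingFree
  | exLE _ _ _ => False
  | exGE _ _ _ => False
  | exEq _ _ _ => False

/-- Membership in the two-variable fragment without counting quantifiers and without equality:
only two variables (the elements of `Fin 2`) are available, every atom is an equality-free atom
with a unary or binary predicate, and no counting quantifier occurs. -/
def IsL2minus (f : Formula (Fin 2)) : Prop :=
  f.AllAtoms Atom.IsUnaryOrBinary ∧ f.CountingFree

end Formula

/-- A positive conjunctive query `∃ x̄ (α₁ ∧ ⋯ ∧ αₙ)`, `n ≥ 1`, whose tuple `ȳ` of free variables
has length `m` and whose tuple `x̄` of quantified variables has length `numEx`. All `αᵢ` are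
equality-free and constant-free, with unary or binary predicates. -/
structure ConjQuery (m : ℕ) where
  numEx : ℕ
  atoms : List (Atom (Fin m ⊕ Fin numEx))
  atoms_ne_nil : atoms ≠ []
  unary_or_binary : ∀ α ∈ atoms, α.IsUnaryOrBinary

/-- Truth of the query in a structure when `ȳ` denotes the tuple `b`. -/
def ConjQuery.Holds {D : Type u} {m : ℕ} (I : Interp D) (ψ : ConjQuery m) (b : Fin m → D) : Prop :=
  ∃ c : Fin ψ.numEx → D, ∀ α ∈ ψ.atoms, α.Holds I (Sum.elim b c)

/-- Ground function-free literals: an atom over individual constants together with a sign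
(`true` for the atom itself, `false` for its negation). -/
abbrev Literal : Type := Bool × Atom ℕ

/-- Truth of a ground literal in a structure. -/
def Literal.Holds {D : Type u} (I : Interp D) : Literal → Prop
  | (true, a) => a.Holds I I.const
  | (false, a) => ¬ a.Holds I I.const

/-- The structure is a model of `Δ ∪ {φ}`. -/
def IsModel {D : Type u} {V : Type} [DecidableEq V] (I : Interp D) (Δ : List Literal)
    (φ : Formula V) : Prop :=
  (∀ l ∈ Δ, Literal.Holds I l) ∧ ∀ e : V → D, φ.Holds I e

/-- The query answering problem for `φ` and `ψ(ȳ)`: an instance is a finite set `Δ` of ground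
function-free literals, presented as a list, and a tuple `ā` of constants of the same arity as
`ȳ`; it is positive if `ψ(ā)` is true in every model of `Δ ∪ {φ}`. -/
def QueryAnswering {V : Type} [DecidableEq V] (φ : Formula V) {m : ℕ} (ψ : ConjQuery m)
    (inst : List Literal × List.Vector ℕ m) : Prop :=
  ∀ (D : Type) (I : Interp D), IsModel I inst.1 φ →
    ψ.Holds I (fun i => I.const (inst.2.get i))

/-- The finite query answering problem: as above, but for finite models only. -/
def FiniteQueryAnswering {V : Type} [DecidableEq V] (φ : Formula V) {m : ℕ} (ψ : ConjQuery m)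
    (inst : List Literal × List.Vector ℕ m) : Prop :=
  ∀ (D : Type) [Finite D] (I : Interp D), IsModel I inst.1 φ →
    ψ.Holds I (fun i => I.const (inst.2.get i))

end DataComplexity

/-! The proof passes through clause theories: some binary relations are to be total, and certain
conjunctions of signed atoms in four variables are to be unsatisfiable. Two variables suffice to
express totality and to make a second predicate hold wherever a given one fails. Violations of
clauses, which need more variables, are left to the conjunctive query.

The query has to find a violation of some clause, and it has no disjunction. This is simulated with
one selector constant per clause: at the selector of clause `i`, every other clause is matched
trivially by sending all its variables to the selector, so the query holds as soon as clause `i` is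
violated in the core. In the intended models a selector guards only core elements for its own
clause, so a match yields a genuine violation. Hence an unsatisfiable theory gives entailment
(`queryAnswering_of_no_model`), and a finite model gives finite non-entailment
(`not_finiteQueryAnswering_of_model`).

For a code `c`, Horn rules describe its evaluation on `[n]`, and one goal clause forbids a result
with head `0`. If the output is `[0]`, the rules force it in every model (`exists_run`), so there is
none. If it is `[1]`, lists truncated at a large bound form a finite model (`truncRel_codeRules`).
Nothing is needed for other outcomes: for a diagonal `c` the two sets of inputs are recursively
inseparable (`exists_inseparable_code`), and deciding either entailment problem would separate them.
-/

namespace DataComplexity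

/-! ### Finite conjunctions in the two-variable fragment -/

namespace Formula

/-- The conjunction of a list of formulas; the empty conjunction is a tautological sentence. -/
def conj : List (Formula (Fin 2)) → Formula (Fin 2)
  | [] => .all 0 (.imp (.atom (.rel 0 [0])) (.atom (.rel 0 [0])))
  | f :: fs => .and f (conj fs)

theorem conj_holds {D : Type} (I : Interp D) (fs : List (Formula (Fin 2))) (e : Fin 2 → D) :
    (conj fs).Holds I e ↔ ∀ f ∈ fs, f.Holds I e := by
  induction fs with
  | nil => simp [conj, Holds]
  | cons f fs ih => simp [conj, Holds, ih]

theorem conj_isL2minus {fs : List (Formula (Fin 2))} (h : ∀ f ∈ fs, f.IsL2minus) :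
    (conj fs).IsL2minus := by
  induction fs with
  | nil => simp [conj, IsL2minus, AllAtoms, CountingFree, Atom.IsUnaryOrBinary]
  | cons f fs ih =>
    have h1 := h f (by simp)
    have h2 := ih fun g hg => h g (by simp [hg])
    exact ⟨⟨h1.1, h2.1⟩, ⟨h1.2, h2.2⟩⟩

theorem conj_isSentence {fs : List (Formula (Fin 2))} (h : ∀ f ∈ fs, f.IsSentence) :
    (conj fs).IsSentence := by
  induction fs with
  | nil => simp [conj, IsSentence, freeVars, Atom.vars]
  | cons f fs ih =>
    have h1 := h f (by simp)
    have h2 := ih fun g hg => h g (by simp [hg])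
    simp only [IsSentence] at h1 h2 ⊢
    simp [conj, freeVars, h1, h2]

end Formula

/-! ### Clause theories and the signature of their encoding -/

/-- A possibly negated atom in the variables `0, …, 3` with a binary predicate: sign, name and the
two arguments. -/
abbrev SignedAtom : Type := Bool × ℕ × Fin 4 × Fin 4

/-- Truth of a signed atom when predicate names denote according to `R`. -/
def SignedAtom.Holds {D : Type} (R : ℕ → D → D → Prop) (v : Fin 4 → D) (a : SignedAtom) : Prop :=
  if a.1 then R a.2.1 (v a.2.2.1) (v a.2.2.2) else ¬ R a.2.1 (v a.2.2.1) (v a.2.2.2)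

/-- A system of constraints on binary relations: some relations are to be total, and certain
conjunctions of signed atoms are to be unsatisfiable. -/
structure ClauseTheory where
  total : List ℕ
  clauses : List (List SignedAtom)

/-- The relations `R` satisfy the constraints of `T` and the ground facts `F`. -/
structure ClauseTheory.IsModel (T : ClauseTheory) (F : List (ℕ × ℕ × ℕ)) {D : Type}
    (R : ℕ → D → D → Prop) (c : ℕ → D) : Prop where
  total : ∀ p ∈ T.total, ∀ x, ∃ y, R p x y
  clauses : ∀ cl ∈ T.clauses, ∀ v, ¬ ∀ a ∈ cl, SignedAtom.Holds R v a
  facts : ∀ f ∈ F, R f.1 (c f.2.1) (c f.2.2)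

/-- The predicates of the encoding of a clause theory: the original predicates, their complements,
a predicate for the intended domain, one for the selectors of clauses, and for each clause number
the predicate of its selector and the guard of its variables. -/
inductive Sym
  | lit (b : Bool) (p : ℕ)
  | core
  | sel
  | key (i : ℕ)
  | guard (i : ℕ)

/-- The name of a predicate of the encoding. -/
def Sym.name : Sym → ℕ
  | lit true p => Nat.pair 0 p
  | lit false p => Nat.pair 1 p
  | core => Nat.pair 2 0
  | sel => Nat.pair 3 0
  | key i => Nat.pair 4 i
  | guard i => Nat.pair 5 i

theorem Sym.name_injective : Function.Injective Sym.name := by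
  intro a b h
  rcases a with ⟨_ | _, p⟩ | _ | _ | i | i <;> rcases b with ⟨_ | _, q⟩ | _ | _ | j | j <;>
    simp_all [Sym.name, Nat.pair_eq_pair]

/-- A binary atom with a predicate of the encoding. -/
def Sym.atom {V : Type} (q : Sym) (u v : V) : Atom V := .rel q.name [u, v]

/-- The binary relation denoted by a predicate of the encoding. -/
def Interp.bin {D : Type} (I : Interp D) (q : Sym) (x y : D) : Prop := I.rel 2 q.name ![x, y]

theorem Sym.atom_holds {D V : Type} (I : Interp D) (e : V → D) (q : Sym) (u v : V) :
    (q.atom u v).Holds I e ↔ I.bin q (e u) (e v) := by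
  have : (fun i : Fin 2 => e ([u, v].get i)) = ![e u, e v] := by
    funext i; fin_cases i <;> rfl
  exact iff_of_eq (congrArg (I.rel 2 q.name) this)

theorem Sym.atom_isUnaryOrBinary {V : Type} (q : Sym) (u v : V) :
    (q.atom u v).IsUnaryOrBinary := Or.inr rfl

/-- The structure in which the predicates of the encoding denote according to `S`. -/
def Interp.ofSym {D : Type} (S : Sym → D → D → Prop) (c : ℕ → D) : Interp D where
  const := c
  rel k p a := ∃ (h : k = 2) (q : Sym), q.name = p ∧ S q (a (Fin.cast h.symm 0))
    (a (Fin.cast h.symm 1))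

theorem Interp.bin_ofSym {D : Type} (S : Sym → D → D → Prop) (c : ℕ → D) (q : Sym) (x y : D) :
    (Interp.ofSym S c).bin q x y ↔ S q x y := by
  constructor
  · rintro ⟨_, q', h, hS⟩
    rw [Sym.name_injective h] at hS
    exact hS
  · exact fun h => ⟨rfl, q, rfl, h⟩

/-! ### Reduction of clause theories to query answering -/

namespace ClauseTheory

variable (T : ClauseTheory)

/-- Every element has a `p`-successor in the intended domain. -/
def totalFormula (p : ℕ) : Formula (Fin 2) :=
  .all 0 (.ex 1 (.and (.atom ((Sym.lit true p).atom 0 1)) (.atom (Sym.core.atom 1 1))))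

/-- Any two elements satisfy `p` or its complement. -/
def complFormula (p : ℕ) : Formula (Fin 2) :=
  .all 0 (.all 1 (.or (.atom ((Sym.lit true p).atom 0 1)) (.atom ((Sym.lit false p).atom 0 1))))

/-- The selector of clause `i` guards the whole intended domain. -/
def guardFormula (i : ℕ) : Formula (Fin 2) :=
  .all 0 (.all 1 (.imp (.and (.atom ((Sym.key i).atom 0 0)) (.atom (Sym.core.atom 1 1)))
    (.atom ((Sym.guard i).atom 0 1))))

/-- The predicates occurring in the clauses. -/
def preds : List ℕ := T.clauses.flatten.map fun a => a.2.1

/-- The two-variable sentence encoding a clause theory. -/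
def sentence : Formula (Fin 2) :=
  .conj (T.total.map totalFormula ++ T.preds.map complFormula ++
    (List.range T.clauses.length).map guardFormula)

theorem sentence_isL2minus : T.sentence.IsL2minus := by
  apply Formula.conj_isL2minus
  simp only [List.mem_append, List.mem_map]
  rintro f ((⟨p, -, rfl⟩ | ⟨p, -, rfl⟩) | ⟨p, -, rfl⟩) <;>
    simp [totalFormula, complFormula, guardFormula, Formula.IsL2minus, Formula.AllAtoms,
      Formula.CountingFree, Sym.atom_isUnaryOrBinary]

theorem sentence_isSentence : T.sentence.IsSentence := by
  apply Formula.conj_isSentence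
  simp only [List.mem_append, List.mem_map]
  rintro f ((⟨p, -, rfl⟩ | ⟨p, -, rfl⟩) | ⟨p, -, rfl⟩) <;>
  · ext x
    fin_cases x <;> simp [totalFormula, complFormula, guardFormula, Formula.freeVars, Sym.atom,
      Atom.vars]

theorem sentence_holds {D : Type} (I : Interp D) (e : Fin 2 → D) :
    T.sentence.Holds I e ↔
      (∀ p ∈ T.total, ∀ x, ∃ y, I.bin (.lit true p) x y ∧ I.bin .core y y) ∧
      (∀ p ∈ T.preds, ∀ x y, I.bin (.lit true p) x y ∨ I.bin (.lit false p) x y) ∧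
      ∀ i < T.clauses.length, ∀ x y, I.bin (.key i) x x → I.bin .core y y →
        I.bin (.guard i) x y := by
  simp [sentence, Formula.conj_holds, or_imp, forall_and, totalFormula, complFormula, guardFormula,
    Formula.Holds, Sym.atom_holds]

/-- The variables of the query: one for the selector and four for each clause. -/
abbrev QueryVar : Type := Option (Fin T.clauses.length × Fin 4)

/-- The atoms of the query: some selector guards variables that satisfy all the clauses. -/
def queryAtoms : List (Atom T.QueryVar) :=
  Sym.sel.atom none none :: (List.finRange T.clauses.length).flatMap fun i =>
    (T.clauses.get i).map (fun a => (Sym.lit a.1 a.2.1).atom (some (i, a.2.2.1))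
      (some (i, a.2.2.2))) ++
    (List.finRange 4).map fun j => (Sym.guard i).atom none (some (i, j))

/-- Renaming of the variables of an atom. -/
def _root_.DataComplexity.Atom.map {V W : Type} (g : V → W) : Atom V → Atom W
  | .rel p args => .rel p (args.map g)
  | .eq s t => .eq (g s) (g t)

/-- The conjunctive query encoding the clauses. -/
noncomputable def query : ConjQuery 0 where
  numEx := Fintype.card T.QueryVar
  atoms := T.queryAtoms.map (Atom.map fun x => Sum.inr (Fintype.equivFin T.QueryVar x))
  atoms_ne_nil := by simp [queryAtoms]
  unary_or_binary := by
    simp only [queryAtoms, List.mem_map]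
    rintro α ⟨β, hβ, rfl⟩
    simp only [List.mem_cons, List.mem_flatMap, List.mem_append, List.mem_map] at hβ
    rcases hβ with rfl | ⟨i, -, ⟨a, -, rfl⟩ | ⟨j, -, rfl⟩⟩ <;> exact Or.inr rfl

theorem forall_mem_queryAtoms (p : Atom T.QueryVar → Prop) :
    (∀ α ∈ T.queryAtoms, p α) ↔ p (Sym.sel.atom none none) ∧ ∀ i : Fin T.clauses.length,
      (∀ a ∈ T.clauses.get i, p ((Sym.lit a.1 a.2.1).atom (some (i, a.2.2.1))
        (some (i, a.2.2.2)))) ∧ ∀ j, p ((Sym.guard i).atom none (some (i, j))) := by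
  rw [queryAtoms, List.forall_mem_cons]
  refine and_congr_right fun _ => ⟨fun h i => ⟨fun a ha => ?_, fun j => ?_⟩, fun h α hα => ?_⟩
  · exact h _ (List.mem_flatMap.2 ⟨i, List.mem_finRange i,
      List.mem_append_left _ (List.mem_map_of_mem ha)⟩)
  · exact h _ (List.mem_flatMap.2 ⟨i, List.mem_finRange i,
      List.mem_append_right _ (List.mem_map_of_mem (List.mem_finRange j))⟩)
  · simp only [List.mem_flatMap, List.mem_append, List.mem_map] at hα
    obtain ⟨i, -, ⟨a, ha, rfl⟩ | ⟨j, -, rfl⟩⟩ := hα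
    · exact (h i).1 a ha
    · exact (h i).2 j

theorem query_holds {D : Type} (I : Interp D) (b : Fin 0 → D) :
    T.query.Holds I b ↔ ∃ s : D, ∃ v : Fin T.clauses.length → Fin 4 → D, I.bin .sel s s ∧
      ∀ i, (∀ a ∈ T.clauses.get i, I.bin (.lit a.1 a.2.1) (v i a.2.2.1) (v i a.2.2.2)) ∧
        ∀ j, I.bin (.guard i) s (v i j) := by
  have key : ∀ w : T.QueryVar → D, ∀ c : Fin T.query.numEx → D,
      (∀ x, c (Fintype.equivFin T.QueryVar x) = w x) →
      ((∀ α ∈ T.query.atoms, α.Holds I (Sum.elim b c)) ↔ I.bin .sel (w none) (w none) ∧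
        ∀ i, (∀ a ∈ T.clauses.get i, I.bin (.lit a.1 a.2.1) (w (some (i, a.2.2.1)))
          (w (some (i, a.2.2.2)))) ∧ ∀ j, I.bin (.guard i) (w none) (w (some (i, j)))) := by
    intro w c hc
    have hmap : ∀ (q : Sym) (x y : T.QueryVar),
        (Atom.map (fun x => (Sum.inr (Fintype.equivFin T.QueryVar x) :
          Fin 0 ⊕ Fin (Fintype.card T.QueryVar))) (q.atom x y)).Holds I (Sum.elim b c) ↔
          I.bin q (w x) (w y) := by
      intro q x y
      rw [← hc x, ← hc y]
      exact Sym.atom_holds I (Sum.elim b c) q (Sum.inr (Fintype.equivFin T.QueryVar x))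
        (Sum.inr (Fintype.equivFin T.QueryVar y))
    refine List.forall_mem_map.trans ((T.forall_mem_queryAtoms _).trans ?_)
    simp only [hmap]
  constructor
  · rintro ⟨c, hc⟩
    exact ⟨_, fun i j => c (Fintype.equivFin T.QueryVar (some (i, j))),
      (key (fun x => c (Fintype.equivFin T.QueryVar x)) c fun _ => rfl).1 hc⟩
  · rintro ⟨s, v, h⟩
    let w : T.QueryVar → D := fun x => x.elim s fun p => v p.1 p.2
    exact ⟨fun k => w ((Fintype.equivFin T.QueryVar).symm k),
      (key w _ fun x => by simp).2 h⟩

/-- The literals making the constant `i` a selector of clause `i` that trivially satisfies all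
other clauses. -/
def selectorLits (i : ℕ) : List Literal :=
  (true, Sym.sel.atom i i) :: (true, (Sym.key i).atom i i) ::
    (((List.range T.clauses.length).filter (· ≠ i)).map fun k =>
      (true, (Sym.guard k).atom i i)) ++
    T.clauses.flatten.map fun a => (true, (Sym.lit a.1 a.2.1).atom i i)

/-- The part of the data that does not depend on the facts. -/
def baseData : List Literal :=
  (true, Sym.core.atom T.clauses.length T.clauses.length) ::
    (List.range T.clauses.length).flatMap T.selectorLits

/-- The literals encoding a fact. -/
def factLits (f : ℕ × ℕ × ℕ) : List Literal :=
  [(true, (Sym.lit true f.1).atom (f.2.1 + T.clauses.length) (f.2.2 + T.clauses.length)),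
    (true, Sym.core.atom (f.2.1 + T.clauses.length) (f.2.1 + T.clauses.length)),
    (true, Sym.core.atom (f.2.2 + T.clauses.length) (f.2.2 + T.clauses.length))]

/-- The data encoding a list of facts. -/
def data (F : List (ℕ × ℕ × ℕ)) : List Literal := T.baseData ++ F.flatMap T.factLits

theorem data_holds {D : Type} (I : Interp D) (F : List (ℕ × ℕ × ℕ)) :
    (∀ l ∈ T.data F, Literal.Holds I l) ↔
      I.bin .core (I.const T.clauses.length) (I.const T.clauses.length) ∧
      (∀ i < T.clauses.length, I.bin .sel (I.const i) (I.const i) ∧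
        I.bin (.key i) (I.const i) (I.const i) ∧
        (∀ k < T.clauses.length, k ≠ i → I.bin (.guard k) (I.const i) (I.const i)) ∧
        ∀ a ∈ T.clauses.flatten, I.bin (.lit a.1 a.2.1) (I.const i) (I.const i)) ∧
      ∀ f ∈ F, I.bin (.lit true f.1) (I.const (f.2.1 + T.clauses.length))
          (I.const (f.2.2 + T.clauses.length)) ∧
        I.bin .core (I.const (f.2.1 + T.clauses.length)) (I.const (f.2.1 + T.clauses.length)) ∧
        I.bin .core (I.const (f.2.2 + T.clauses.length)) (I.const (f.2.2 + T.clauses.length)) := by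
  have hflat : ∀ {α : Type} (L : List α) (g : α → List Literal),
      (∀ l ∈ L.flatMap g, Literal.Holds I l) ↔ ∀ x ∈ L, ∀ l ∈ g x, Literal.Holds I l := by
    intro α L g
    simp only [List.mem_flatMap]
    exact ⟨fun h x hx l hl => h l ⟨x, hx, hl⟩, fun h l ⟨x, hx, hl⟩ => h x hx l hl⟩
  have hat : ∀ (q : Sym) (x y : ℕ), Literal.Holds I (true, q.atom x y) ↔
      I.bin q (I.const x) (I.const y) := fun q x y => Sym.atom_holds I I.const q x y
  simp only [data, baseData, List.forall_mem_append, List.forall_mem_cons, hflat, hat,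
    selectorLits, factLits, List.forall_mem_map, List.mem_range, List.mem_filter,
    decide_eq_true_eq, List.cons_append, and_imp]
  simp

/-- If a clause theory has no model, the query is entailed by its encoding. -/
theorem queryAnswering_of_no_model {F : List (ℕ × ℕ × ℕ)}
    (h : ∀ (D : Type) (R : ℕ → D → D → Prop) (c : ℕ → D), ¬ T.IsModel F R c)
    (u : List.Vector ℕ 0) : QueryAnswering T.sentence T.query (T.data F, u) := by
  intro D I ⟨hdata, hsent⟩
  by_contra hq
  obtain ⟨hcore, hsel, hfact⟩ := (T.data_holds I F).1 hdata
  obtain ⟨htot, hcompl, hguard⟩ := (T.sentence_holds I _).1 (hsent fun _ => I.const 0)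
  rw [query_holds] at hq
  classical
  -- The model is the core of `I`. Constants not mentioned in the facts need not lie in it, so they
  -- default to the constant that `baseData` puts there.
  let c : ℕ → {x // I.bin .core x x} := fun k =>
    if hk : I.bin .core (I.const (k + T.clauses.length)) (I.const (k + T.clauses.length)) then
      ⟨_, hk⟩ else ⟨_, hcore⟩
  refine h {x // I.bin .core x x} (fun p x y => I.bin (.lit true p) x y) c ⟨?_, ?_, ?_⟩
  · intro p hp x
    obtain ⟨y, hy, hy'⟩ := htot p hp x
    exact ⟨⟨y, hy'⟩, hy⟩
  · intro cl hcl v hv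
    obtain ⟨i, hi, rfl⟩ := List.getElem_of_mem hcl
    -- A violation of clause `i` gives a match of the whole query: its selector is `i`, and the
    -- variables of all other clauses collapse to that selector.
    refine hq ⟨I.const i, fun k j => if k = i then v j else I.const i, (hsel i hi).1, ?_⟩
    intro k
    by_cases hk : (k : ℕ) = i
    · simp only [hk, if_true]
      refine ⟨fun a ha => ?_, fun j => hguard i hi _ _ (hsel i hi).2.1 (v j).2⟩
      have ha' : a ∈ T.clauses[i] := by simpa [hk] using ha
      have := hv a ha'
      rcases a with ⟨_ | _, p, x, y⟩
      · simp only [SignedAtom.Holds, Bool.false_eq_true, if_false] at this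
        -- Only this direction is available, and it suffices: a predicate and its "complement" may
        -- overlap, but they cover all pairs.
        refine (hcompl p ?_ _ _).resolve_left this
        exact List.mem_map.2 ⟨_, List.mem_flatten.2 ⟨_, hcl, ha'⟩, rfl⟩
      · simpa only [SignedAtom.Holds, if_true] using this
    · simp only [hk, if_false]
      exact ⟨fun a ha => (hsel i hi).2.2.2 a
        (List.mem_flatten.2 ⟨_, List.get_mem _ _, ha⟩), fun j => (hsel i hi).2.2.1 k k.2 hk⟩
  · intro f hf
    obtain ⟨h1, h2, h3⟩ := hfact f hf
    simpa [c, h2, h3] using h1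

/-- The interpretation of the predicates of the encoding in the disjoint union of a model of the
clause theory and a set of selectors. -/
def symRel {D : Type} (R : ℕ → D → D → Prop) {n : ℕ} : Sym → D ⊕ Fin n → D ⊕ Fin n → Prop
  | .lit true p, .inl a, .inl b => R p a b
  | .lit false p, .inl a, .inl b => ¬ R p a b
  | .lit _ _, _, _ => True
  | .core, x, _ => x.isLeft
  | .sel, x, _ => x.isRight
  | .key k, x, _ => ∃ i : Fin n, x = .inr i ∧ (i : ℕ) = k
  -- The selector of clause `k` guards exactly the core, and every other element guards exactly the
  -- selectors; this includes the loops demanded by `selectorLits`.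
  | .guard k, x, y => (∃ i : Fin n, x = .inr i ∧ (i : ℕ) = k) ↔ y.isLeft

/-- A finite model of a clause theory refutes the query. -/
theorem not_finiteQueryAnswering_of_model {F : List (ℕ × ℕ × ℕ)} {D : Type} [Finite D]
    {R : ℕ → D → D → Prop} {c : ℕ → D} (h : T.IsModel F R c) (u : List.Vector ℕ 0) :
    ¬ FiniteQueryAnswering T.sentence T.query (T.data F, u) := by
  intro hq
  let c' : ℕ → D ⊕ Fin T.clauses.length := fun k =>
    if hk : k < T.clauses.length then .inr ⟨k, hk⟩ else .inl (c (k - T.clauses.length))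
  have hc : ∀ k, c' (k + T.clauses.length) = .inl (c k) := fun k => by simp [c']
  have hc0 : c' T.clauses.length = .inl (c 0) := by simp [c']
  have hs : ∀ k (hk : k < T.clauses.length), c' k = .inr ⟨k, hk⟩ := fun k hk => by simp [c', hk]
  have := hq _ (Interp.ofSym (symRel R) c') ⟨?_, fun e => ?_⟩
  · obtain ⟨s, v, hsel, hv⟩ := (T.query_holds _ _).1 this
    simp only [Interp.bin_ofSym] at hsel hv
    rcases s with s | i
    · simp [symRel] at hsel
    · obtain ⟨h1, h2⟩ := hv i
      -- For its own clause a selector guards no selector, so the match of clause `i` lies in the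
      -- given model.
      have h3 : ∀ j, ∃ x, v i j = .inl x := fun j => by
        have := h2 j
        simpa [symRel, Sum.isLeft_iff] using this
      choose w hw using h3
      refine h.clauses _ (List.get_mem T.clauses i) w fun a ha => ?_
      have := h1 a ha
      rcases a with ⟨_ | _, p, x, y⟩ <;> simpa [hw, symRel, SignedAtom.Holds] using this
  · refine (T.data_holds _ F).2 ?_
    simp only [Interp.bin_ofSym]
    simp only [Interp.ofSym, hc, hc0]
    refine ⟨by simp [symRel], fun i hi => ?_, fun f hf => ⟨?_, by simp [symRel], by simp [symRel]⟩⟩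
    · simp only [hs i hi]
      refine ⟨by simp [symRel], by simp [symRel], fun k _ hk => ?_, fun a _ => ?_⟩
      · simp [symRel, hk.symm]
      · rcases a with ⟨_ | _, p, x, y⟩ <;> simp [symRel]
    · exact h.facts f hf
  · refine (T.sentence_holds _ _).2 ?_
    simp only [Interp.bin_ofSym]
    refine ⟨fun p hp x => ?_, fun p _ x y => ?_, fun i hi x y hx hy => ?_⟩
    · rcases x with x | x
      · obtain ⟨y, hy⟩ := h.total p hp x
        exact ⟨.inl y, by simpa [symRel] using hy⟩
      -- Every literal holds as soon as one argument is a selector, so any core element serves as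
      -- successor.
      · exact ⟨.inl (c 0), by simp [symRel]⟩
    · rcases x with x | x <;> rcases y with y | y <;> simp [symRel, em]
    · simp only [symRel] at hx hy ⊢
      exact ⟨fun _ => hy, fun _ => hx⟩

end ClauseTheory
end DataComplexity

/-! ### Horn rules for the evaluation of codes on lists -/

namespace DataComplexity

open Turing.ToPartrec (Code)

/-- An injective numbering of codes. -/
def codeName : Code → ℕ
  | .zero' => Nat.pair 0 0
  | .succ => Nat.pair 1 0
  | .tail => Nat.pair 2 0
  | .cons f g => Nat.pair 3 (Nat.pair (codeName f) (codeName g))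
  | .comp f g => Nat.pair 4 (Nat.pair (codeName f) (codeName g))
  | .case f g => Nat.pair 5 (Nat.pair (codeName f) (codeName g))
  | .fix f => Nat.pair 6 (codeName f)

theorem codeName_injective : Function.Injective codeName := by
  intro a
  induction a with
  | zero' | succ | tail => intro b h; cases b <;> simp_all [codeName, Nat.pair_eq_pair]
  | cons f g hf hg | comp f g hf hg | case f g hf hg =>
    intro b h
    cases b <;> simp [codeName, Nat.pair_eq_pair] at h ⊢
    exact ⟨hf h.1, hg h.2⟩
  | fix f hf =>
    intro b h
    cases b <;> simp [codeName, Nat.pair_eq_pair] at h ⊢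
    exact hf h

/-- The predicates describing the evaluation of codes on lists of natural numbers. Properties of
lists are represented by subrelations of the identity. -/
inductive ListRel
  | nil
  | push
  | incr
  | tail
  | head
  | zero
  | pos
  | nonempty
  | start
  | run (c : Code)

/-- The name of a predicate on lists. -/
def ListRel.name : ListRel → ℕ
  | nil => Nat.pair 0 0
  | push => Nat.pair 1 0
  | incr => Nat.pair 2 0
  | tail => Nat.pair 3 0
  | head => Nat.pair 4 0
  | zero => Nat.pair 5 0
  | pos => Nat.pair 6 0
  | nonempty => Nat.pair 7 0
  | start => Nat.pair 8 0
  | run c => Nat.pair 9 (codeName c)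

theorem ListRel.name_injective : Function.Injective ListRel.name := by
  intro a b h
  cases a <;> cases b <;> simp_all [ListRel.name, Nat.pair_eq_pair, codeName_injective.eq_iff]

/-- The clause stating that the atoms in `body` imply `head`. -/
def hornClause (body : List (ListRel × Fin 4 × Fin 4)) (head : ListRel × Fin 4 × Fin 4) :
    List SignedAtom :=
  (false, head.1.name, head.2) :: body.map fun b => (true, b.1.name, b.2)

/-- The clause stating that the atoms in `body` are not jointly satisfiable. -/
def goalClause (body : List (ListRel × Fin 4 × Fin 4)) : List SignedAtom :=
  body.map fun b => (true, b.1.name, b.2)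

/-- The relations `R` satisfy the clauses `L`. -/
def SatClauses {D : Type} (R : ℕ → D → D → Prop) (L : List (List SignedAtom)) : Prop :=
  ∀ cl ∈ L, ∀ v, ¬ ∀ a ∈ cl, SignedAtom.Holds R v a

section

variable {D : Type} (R : ℕ → D → D → Prop)

theorem satClauses_nil : SatClauses R [] := by simp [SatClauses]

theorem satClauses_cons {cl : List SignedAtom} {L : List (List SignedAtom)} :
    SatClauses R (cl :: L) ↔ (∀ v, ¬ ∀ a ∈ cl, SignedAtom.Holds R v a) ∧ SatClauses R L := by
  simp [SatClauses]

theorem satClauses_append {L L' : List (List SignedAtom)} :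
    SatClauses R (L ++ L') ↔ SatClauses R L ∧ SatClauses R L' := by
  simp [SatClauses, or_imp, forall_and]

theorem forall_fin_four {p : (Fin 4 → D) → Prop} : (∀ v, p v) ↔ ∀ x y z w, p ![x, y, z, w] := by
  refine ⟨fun h x y z w => h _, fun h v => ?_⟩
  have : v = ![v 0, v 1, v 2, v 3] := by funext i; fin_cases i <;> rfl
  rw [this]
  exact h _ _ _ _

theorem sat_hornClause {body : List (ListRel × Fin 4 × Fin 4)} {head : ListRel × Fin 4 × Fin 4} :
    (∀ v, ¬ ∀ a ∈ hornClause body head, SignedAtom.Holds R v a) ↔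
      ∀ x y z w : D,
        (∀ b ∈ body, R b.1.name (![x, y, z, w] b.2.1) (![x, y, z, w] b.2.2)) →
        R head.1.name (![x, y, z, w] head.2.1) (![x, y, z, w] head.2.2) := by
  rw [forall_fin_four]
  refine forall_congr' fun x => forall_congr' fun y => forall_congr' fun z =>
    forall_congr' fun w => ?_
  simp only [hornClause, List.forall_mem_cons, List.forall_mem_map, SignedAtom.Holds,
    Bool.false_eq_true, if_false, if_true]
  tauto

theorem sat_goalClause {body : List (ListRel × Fin 4 × Fin 4)} :
    (∀ v, ¬ ∀ a ∈ goalClause body, SignedAtom.Holds R v a) ↔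
      ∀ x y z w : D, ¬ ∀ b ∈ body, R b.1.name (![x, y, z, w] b.2.1) (![x, y, z, w] b.2.2) := by
  rw [forall_fin_four]
  simp only [goalClause, List.forall_mem_map, SignedAtom.Holds, if_true]

end

/-- The clauses about the basic predicates on lists. -/
def listClauses : List (List SignedAtom) :=
  [hornClause [(.nil, 0, 0)] (.zero, 0, 0),
    hornClause [(.push, 0, 1)] (.zero, 1, 1),
    hornClause [(.incr, 0, 1)] (.pos, 1, 1),
    hornClause [(.push, 0, 1)] (.nonempty, 1, 1),
    hornClause [(.incr, 0, 1)] (.nonempty, 1, 1),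
    hornClause [(.zero, 0, 0), (.zero, 1, 1)] (.head, 0, 1),
    hornClause [(.incr, 0, 1), (.incr, 2, 3), (.head, 0, 2)] (.head, 1, 3),
    hornClause [(.nil, 0, 0)] (.tail, 0, 0),
    hornClause [(.push, 0, 1)] (.tail, 1, 0),
    hornClause [(.incr, 0, 1), (.tail, 0, 2)] (.tail, 1, 2)]

/-- The rules expressed by `listClauses`. -/
structure ListRules {D : Type} (S : ListRel → D → D → Prop) : Prop where
  zero_of_nil : ∀ x, S .nil x x → S .zero x x
  zero_of_push : ∀ x y, S .push x y → S .zero y y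
  pos_of_incr : ∀ x y, S .incr x y → S .pos y y
  nonempty_of_push : ∀ x y, S .push x y → S .nonempty y y
  nonempty_of_incr : ∀ x y, S .incr x y → S .nonempty y y
  head_of_zero : ∀ x y, S .zero x x → S .zero y y → S .head x y
  head_of_incr : ∀ x x' y y', S .incr x x' → S .incr y y' → S .head x y → S .head x' y'
  tail_of_nil : ∀ x, S .nil x x → S .tail x x
  tail_of_push : ∀ x y, S .push x y → S .tail y x
  tail_of_incr : ∀ x y z, S .incr x y → S .tail x z → S .tail y z

theorem satClauses_listClauses {D : Type} {R : ℕ → D → D → Prop} :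
    SatClauses R listClauses ↔ ListRules fun q => R q.name := by
  simp only [listClauses, satClauses_cons, sat_hornClause, satClauses_nil, and_true,
    List.forall_mem_cons, List.not_mem_nil, false_imp_iff, implies_true, and_imp,
    Matrix.cons_val]
  constructor
  · rintro ⟨h1, h2, h3, h4, h5, h6, h7, h8, h9, h10⟩
    exact ⟨fun x => h1 x x x x, fun x y => h2 x y x x, fun x y => h3 x y x x,
      fun x y => h4 x y x x, fun x y => h5 x y x x, fun x y => h6 x y x x, h7, fun x => h8 x x x x,
      fun x y => h9 x y x x, fun x y z => h10 x y z x⟩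
  · rintro ⟨h1, h2, h3, h4, h5, h6, h7, h8, h9, h10⟩
    exact ⟨fun x _ _ _ => h1 x, fun x y _ _ => h2 x y, fun x y _ _ => h3 x y,
      fun x y _ _ => h4 x y, fun x y _ _ => h5 x y, fun x y _ _ => h6 x y, h7,
      fun x _ _ _ => h8 x, fun x y _ _ => h9 x y, fun x y z _ => h10 x y z⟩

/-- The clauses about the evaluation of a code and its subcodes. -/
def codeClauses : Code → List (List SignedAtom)
  | .zero' => [hornClause [(.push, 0, 1)] (.run .zero', 0, 1)]
  | .succ => [hornClause [(.incr, 2, 1), (.head, 0, 2), (.tail, 2, 3), (.nil, 3, 3)]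
      (.run .succ, 0, 1)]
  | .tail => [hornClause [(.tail, 0, 1)] (.run .tail, 0, 1)]
  -- The truncated model gives `[]` the same head and tail as `[0]`; `nonempty` tells them apart
  -- here and in the successor rule for `case`.
  | .cons f g => hornClause [(.run f, 0, 1), (.run g, 0, 2), (.tail, 3, 2), (.head, 3, 1),
      (.nonempty, 3, 3)] (.run (.cons f g), 0, 3) :: (codeClauses f ++ codeClauses g)
  | .comp f g => hornClause [(.run g, 0, 1), (.run f, 1, 2)] (.run (.comp f g), 0, 2) ::
      (codeClauses f ++ codeClauses g)
  | .case f g => hornClause [(.zero, 0, 0), (.tail, 0, 1), (.run f, 1, 2)]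
      (.run (.case f g), 0, 2) ::
      hornClause [(.nonempty, 1, 1), (.incr, 1, 0), (.run g, 1, 2)] (.run (.case f g), 0, 2) ::
      (codeClauses f ++ codeClauses g)
  | .fix f => hornClause [(.run f, 0, 1), (.zero, 1, 1), (.tail, 1, 2)] (.run (.fix f), 0, 2) ::
      hornClause [(.run f, 0, 1), (.pos, 1, 1), (.tail, 1, 2), (.run (.fix f), 2, 3)]
        (.run (.fix f), 0, 3) :: codeClauses f

/-- The rules expressed by `codeClauses`. -/
def CodeRules {D : Type} (S : ListRel → D → D → Prop) : Code → Prop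
  | .zero' => ∀ x y, S .push x y → S (.run .zero') x y
  | .succ => ∀ x y z w, S .incr z y → S .head x z → S .tail z w → S .nil w w → S (.run .succ) x y
  | .tail => ∀ x y, S .tail x y → S (.run .tail) x y
  | .cons f g => (∀ x y z w, S (.run f) x y → S (.run g) x z → S .tail w z → S .head w y →
      S .nonempty w w → S (.run (.cons f g)) x w) ∧ CodeRules S f ∧ CodeRules S g
  | .comp f g => (∀ x y z, S (.run g) x y → S (.run f) y z → S (.run (.comp f g)) x z) ∧
      CodeRules S f ∧ CodeRules S g
  | .case f g => (∀ x y z, S .zero x x → S .tail x y → S (.run f) y z →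
        S (.run (.case f g)) x z) ∧
      (∀ x y z, S .nonempty y y → S .incr y x → S (.run g) y z → S (.run (.case f g)) x z) ∧
      CodeRules S f ∧ CodeRules S g
  | .fix f => (∀ x y z, S (.run f) x y → S .zero y y → S .tail y z → S (.run (.fix f)) x z) ∧
      (∀ x y z w, S (.run f) x y → S .pos y y → S .tail y z → S (.run (.fix f)) z w →
        S (.run (.fix f)) x w) ∧ CodeRules S f

theorem satClauses_codeClauses {D : Type} {R : ℕ → D → D → Prop} (c : Code) :
    SatClauses R (codeClauses c) ↔ CodeRules (fun q => R q.name) c := by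
  induction c with
  | zero' | succ | tail | cons f g hf hg | comp f g hf hg | case f g hf hg | fix f hf =>
    simp only [codeClauses, CodeRules, satClauses_cons, satClauses_append, sat_hornClause,
      satClauses_nil, and_true, List.forall_mem_cons, List.not_mem_nil, false_imp_iff,
      implies_true, and_imp, Matrix.cons_val, *]
    try
      constructor
      · intro h
        first
        | exact fun x y => h x y x x
        | exact ⟨fun x y z => h.1 x y z x, h.2⟩
        | exact ⟨fun x y z => h.1 x y z x, fun x y z => h.2.1 x y z x, h.2.2⟩
      · intro h
        first
        | exact fun x y _ _ => h x y
        | exact ⟨fun x y z _ => h.1 x y z, h.2⟩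
        | exact ⟨fun x y z _ => h.1 x y z, fun x y z _ => h.2.1 x y z, h.2.2⟩

/-! ### Big-step evaluation with bounded lists -/

/-- Big-step evaluation of codes in which inputs of subroutines and results satisfy `P`. -/
inductive BigStep (P : List ℕ → Prop) : Code → List ℕ → List ℕ → Prop
  | zero' {v} : P (0 :: v) → BigStep P .zero' v (0 :: v)
  | succ {v} : P [v.headI + 1] → BigStep P .succ v [v.headI + 1]
  | tail {v} : P v.tail → BigStep P .tail v v.tail
  | cons {f g v a b} : BigStep P f v a → BigStep P g v b → P b → P (a.headI :: b) →
      BigStep P (.cons f g) v (a.headI :: b)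
  | comp {f g v a b} : BigStep P g v a → BigStep P f a b → BigStep P (.comp f g) v b
  | case_zero {f g v a} : v.headI = 0 → P v.tail → BigStep P f v.tail a →
      BigStep P (.case f g) v a
  | case_succ {f g v n a} : v.headI = n + 1 → P v → BigStep P g (n :: v.tail) a →
      BigStep P (.case f g) v a
  | fix_zero {f v a} : BigStep P f v a → a.headI = 0 → P a.tail → BigStep P (.fix f) v a.tail
  | fix_succ {f v a b} : BigStep P f v a → a.headI ≠ 0 → P a.tail → BigStep P (.fix f) a.tail b →
      BigStep P (.fix f) v b

open Filter in
/-- If the properties `P M` eventually hold of every list, then evaluation is eventually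
captured by big-step evaluation relative to `P M`. -/
theorem eventually_bigStep {P : ℕ → List ℕ → Prop} (hP : ∀ l, ∀ᶠ M in atTop, P M l) (c : Code)
    {v w : List ℕ} (h : w ∈ c.eval v) : ∀ᶠ M in atTop, BigStep (P M) c v w := by
  induction c generalizing v w with
  | zero' =>
    simp at h; subst h
    exact (hP _).mono fun M => .zero'
  | succ =>
    simp at h; subst h
    exact (hP _).mono fun M => .succ
  | tail =>
    simp at h; subst h
    exact (hP _).mono fun M => .tail
  | cons f g hf hg =>
    simp at h
    obtain ⟨a, ha, b, hb, rfl⟩ := h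
    filter_upwards [hf ha, hg hb, hP b, hP (a.headI :: b)] with M h1 h2 h3 h4
    exact .cons h1 h2 h3 h4
  | comp f g hf hg =>
    rw [Turing.ToPartrec.Code.comp_eval] at h
    obtain ⟨a, ha, hb⟩ := Part.mem_bind_iff.1 h
    filter_upwards [hg ha, hf hb] with M h1 h2
    exact .comp h1 h2
  | case f g hf hg =>
    rw [Turing.ToPartrec.Code.case_eval] at h
    rcases hv : v.headI with _ | n
    · simp only [hv] at h
      filter_upwards [hf h, hP v.tail] with M h1 h2
      exact .case_zero hv h2 h1
    · simp only [hv] at h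
      filter_upwards [hg h, hP v] with M h1 h2
      exact .case_succ hv h2 h1
  | fix f hf =>
    rw [Turing.ToPartrec.Code.fix_eval] at h
    -- A terminating loop has finitely many iterations, so the finitely many "eventually" conditions
    -- can be intersected along it.
    refine PFun.fixInduction' (C := fun v => ∀ᶠ M in atTop, BigStep (P M) f.fix v w) h
      (fun v hv => ?_) fun v v' _ hv ih => ?_
    · simp only [Part.mem_map_iff] at hv
      obtain ⟨a, ha, hv⟩ := hv
      split_ifs at hv with h0
      obtain rfl := Sum.inl.inj hv
      filter_upwards [hf ha, hP a.tail] with M h1 h2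
      exact .fix_zero h1 h0 h2
    · simp only [Part.mem_map_iff] at hv
      obtain ⟨a, ha, hv⟩ := hv
      split_ifs at hv with h0
      obtain rfl := Sum.inr.inj hv
      filter_upwards [hf ha, hP a.tail, ih] with M h1 h2 h3
      exact .fix_succ h1 h0 h2 h3

/-! ### Every model of the rules computes the correct results -/

section Representation

variable {D : Type} {S : ListRel → D → D → Prop}

/-- The element `x` is obtained from an empty list by the operations that build the list. -/
inductive Represents (S : ListRel → D → D → Prop) : List ℕ → D → Prop
  | nil {x} : S .nil x x → Represents S [] x
  | push {l x y} : Represents S l x → S .push x y → Represents S (0 :: l) y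
  | incr {n l x y} : Represents S (n :: l) x → S .incr x y → Represents S ((n + 1) :: l) y

/-- The basic rules hold, an empty list exists, and lists can be extended and incremented. -/
structure ListModel (S : ListRel → D → D → Prop) : Prop where
  rules : ListRules S
  exists_nil : ∃ x, S .nil x x
  exists_push : ∀ x, ∃ y, S .push x y
  exists_incr : ∀ x, ∃ y, S .incr x y

namespace ListModel

theorem exists_represents_cons (h : ListModel S) {l : List ℕ} {x : D} (hx : Represents S l x)
    (n : ℕ) :
    ∃ y, Represents S (n :: l) y ∧ S .tail y x ∧ S .nonempty y y := by
  induction n with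
  | zero =>
    obtain ⟨y, hy⟩ := h.exists_push x
    exact ⟨y, .push hx hy, h.rules.tail_of_push _ _ hy, h.rules.nonempty_of_push _ _ hy⟩
  | succ n ih =>
    obtain ⟨y, hy, ht, -⟩ := ih
    obtain ⟨z, hz⟩ := h.exists_incr y
    exact ⟨z, .incr hy hz, h.rules.tail_of_incr _ _ _ hz ht, h.rules.nonempty_of_incr _ _ hz⟩

theorem nonempty_of_represents (h : ListModel S) {n : ℕ} {l : List ℕ} {x : D}
    (hx : Represents S (n :: l) x) :
    S .nonempty x x := by
  cases hx with
  | push _ hy => exact h.rules.nonempty_of_push _ _ hy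
  | incr _ hy => exact h.rules.nonempty_of_incr _ _ hy

theorem exists_tail (h : ListModel S) {l : List ℕ} {x : D} (hx : Represents S l x) :
    ∃ y, Represents S l.tail y ∧ S .tail x y := by
  induction hx with
  | nil hx => exact ⟨_, .nil hx, h.rules.tail_of_nil _ hx⟩
  | push hx hy => exact ⟨_, hx, h.rules.tail_of_push _ _ hy⟩
  | incr _ hy ih =>
    obtain ⟨z, hz, ht⟩ := ih
    exact ⟨z, hz, h.rules.tail_of_incr _ _ _ hy ht⟩

theorem zero_of_represents (h : ListModel S) {l : List ℕ} {x : D}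
    (hx : Represents S l x) (h0 : l.headI = 0) :
    S .zero x x := by
  cases hx with
  | nil hx => exact h.rules.zero_of_nil _ hx
  | push _ hy => exact h.rules.zero_of_push _ _ hy
  | incr _ _ => simp at h0

theorem pos_of_represents (h : ListModel S) {l : List ℕ} {x : D}
    (hx : Represents S l x) (h0 : l.headI ≠ 0) :
    S .pos x x := by
  cases hx with
  | nil _ => exact absurd rfl h0
  | push _ _ => exact absurd rfl h0
  | incr _ hy => exact h.rules.pos_of_incr _ _ hy

/-- Without equality, heads are compared by decrementing both in parallel until both are zero. The
tails play no role, so the two lists may differ there. -/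
theorem head_of_represents (h : ListModel S) {l l' : List ℕ} {x y : D} (hx : Represents S l x)
    (hy : Represents S l' y) (hh : l.headI = l'.headI) : S .head x y := by
  induction hx generalizing l' y with
  | nil hx =>
    exact h.rules.head_of_zero _ _ (h.rules.zero_of_nil _ hx)
      (h.zero_of_represents hy (by simpa using hh.symm))
  | push _ hx =>
    exact h.rules.head_of_zero _ _ (h.rules.zero_of_push _ _ hx)
      (h.zero_of_represents hy (by simpa using hh.symm))
  | incr _ hx ih =>
    cases hy with
    | nil _ => simp at hh
    | push _ _ => simp at hh
    | incr hy hy' => exact h.rules.head_of_incr _ _ _ _ hx hy' (ih hy (by simpa using hh))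

/-- The rules force the intended results of evaluations. -/
theorem exists_run (h : ListModel S) {P : List ℕ → Prop} {c : Code} {v w : List ℕ}
    (hc : CodeRules S c)
    (he : BigStep P c v w) {x : D} (hx : Represents S v x) :
    ∃ z, Represents S w z ∧ S (.run c) x z := by
  induction he generalizing x with
  | zero' _ =>
    obtain ⟨y, hy⟩ := h.exists_push x
    exact ⟨y, .push hx hy, hc _ _ hy⟩
  | @succ v _ =>
    obtain ⟨e, hn⟩ := h.exists_nil
    obtain ⟨y, hy, ht, -⟩ := h.exists_represents_cons (.nil hn) v.headI
    obtain ⟨z, hz⟩ := h.exists_incr y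
    exact ⟨z, .incr hy hz, hc _ _ _ _ hz (h.head_of_represents hx hy rfl) ht hn⟩
  | tail _ =>
    obtain ⟨y, hy, ht⟩ := h.exists_tail hx
    exact ⟨y, hy, hc _ _ ht⟩
  | @cons f g v a b _ _ _ _ hf hg =>
    obtain ⟨y, hy, hfy⟩ := hf hc.2.1 hx
    obtain ⟨z, hz, hgz⟩ := hg hc.2.2 hx
    obtain ⟨w, hw, ht, hne⟩ := h.exists_represents_cons hz a.headI
    exact ⟨w, hw, hc.1 _ _ _ _ hfy hgz ht (h.head_of_represents hw hy rfl) hne⟩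
  | comp _ _ hg hf =>
    obtain ⟨y, hy, hgy⟩ := hg hc.2.2 hx
    obtain ⟨z, hz, hfz⟩ := hf hc.2.1 hy
    exact ⟨z, hz, hc.1 _ _ _ hgy hfz⟩
  | case_zero h0 _ _ hf =>
    obtain ⟨y, hy, ht⟩ := h.exists_tail hx
    obtain ⟨z, hz, hfz⟩ := hf hc.2.2.1 hy
    exact ⟨z, hz, hc.1 _ _ _ (h.zero_of_represents hx h0) ht hfz⟩
  | case_succ h0 _ _ hg =>
    -- A list with positive head was built by `incr`, so its representation already contains an
    -- element for the decremented list.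
    cases hx with
    | nil _ => simp at h0
    | push _ _ => simp at h0
    | incr hy hyx =>
      simp only [List.headI_cons, Nat.add_right_cancel_iff] at h0
      subst h0
      obtain ⟨z, hz, hgz⟩ := hg hc.2.2.2 hy
      exact ⟨z, hz, hc.2.1 _ _ _ (h.nonempty_of_represents hy) hyx hgz⟩
  | fix_zero _ h0 _ hf =>
    obtain ⟨y, hy, hfy⟩ := hf hc.2.2 hx
    obtain ⟨z, hz, ht⟩ := h.exists_tail hy
    exact ⟨z, hz, hc.1 _ _ _ hfy (h.zero_of_represents hy h0) ht⟩
  | fix_succ _ h0 _ _ hf hfix =>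
    obtain ⟨y, hy, hfy⟩ := hf hc.2.2 hx
    obtain ⟨z, hz, ht⟩ := h.exists_tail hy
    -- The induction is on the evaluation, not on the code, so the rules for the same loop apply to
    -- the remaining iterations.
    obtain ⟨w, hw, hzw⟩ := hfix hc hz
    exact ⟨w, hw, hc.2.1 _ _ _ _ hfy (h.pos_of_represents hy h0) ht hzw⟩

end ListModel

end Representation

/-! ### The finite model of truncated lists -/

section Truncation

/-- Lists with at most `M` entries, all of them at most `M`. -/
abbrev BoundedList (M : ℕ) : Type := {l : List ℕ // l.length ≤ M ∧ ∀ a ∈ l, a ≤ M}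

instance (M : ℕ) : Finite (BoundedList M) := by
  have h : ((fun l : List (Fin (M + 1)) => l.map Fin.val) ''
      {l : List (Fin (M + 1)) | l.length ≤ M}).Finite :=
    (List.finite_length_le _ M).image _
  refine (h.subset ?_).to_subtype
  rintro l ⟨hl, ha⟩
  refine ⟨l.pmap (fun a ha => (⟨a, Nat.lt_succ_of_le ha⟩ : Fin (M + 1))) ha, by simpa using hl, ?_⟩
  simp [List.map_pmap]

/-- Lists that are so small that the operations with truncation are exact on them. -/
def IsSmall (M : ℕ) (l : List ℕ) : Prop := l.length + 2 ≤ M ∧ ∀ a ∈ l, a < M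

open Filter in
theorem eventually_isSmall (l : List ℕ) : ∀ᶠ M in atTop, IsSmall M l :=
  (eventually_ge_atTop _).and <|
    (eventually_all_finite l.finite_toSet).2 fun a _ => eventually_gt_atTop a

theorem headI_cons_tail {l : List ℕ} (h : l ≠ []) : l.headI :: l.tail = l := by
  cases l with
  | nil => exact absurd rfl h
  | cons _ _ => rfl

/-- The operations on lists, truncated to lists with entries and length at most `M`. -/
def truncRel (M n : ℕ) : ListRel → BoundedList M → BoundedList M → Prop
  | .nil, x, _ => x.1 = []
  | .push, x, y => y.1 = (0 :: x.1).take M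
  | .incr, x, y => y.1 = min (x.1.headI + 1) M :: x.1.tail
  -- Comparing only `M - 1` entries makes `tail_of_push` survive when `push` drops the last entry of
  -- a full list.
  | .tail, x, y => y.1.take (M - 1) = x.1.tail
  | .head, x, y => x.1.headI = y.1.headI
  | .zero, x, _ => x.1.headI = 0
  | .pos, x, _ => x.1.headI ≠ 0
  | .nonempty, x, _ => x.1 ≠ []
  | .start, x, _ => x.1 = [n]
  -- The relation is full wherever no small evaluation exists, so inexact computations cannot
  -- violate a rule.
  | .run c, x, y => ∀ l, BigStep (IsSmall M) c x.1 l → y.1 = l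

variable {M n : ℕ}

theorem truncRel_listRules (hM : 2 ≤ M) : ListRules (truncRel M n) where
  zero_of_nil x h := by simp_all [truncRel]
  zero_of_push x y h := by
    obtain ⟨M, rfl⟩ : ∃ k, M = k + 1 := ⟨M - 1, by omega⟩
    simp_all [truncRel]
  pos_of_incr x y h := by simp_all [truncRel]; omega
  nonempty_of_push x y h := by
    obtain ⟨M, rfl⟩ : ∃ k, M = k + 1 := ⟨M - 1, by omega⟩
    simp_all [truncRel]
  nonempty_of_incr x y h := by simp_all [truncRel]
  head_of_zero x y h h' := by simp_all [truncRel]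
  head_of_incr x x' y y' h h' h'' := by simp_all [truncRel]
  tail_of_nil x h := by simp_all [truncRel]
  tail_of_push x y h := by
    obtain ⟨M, rfl⟩ : ∃ k, M = k + 1 := ⟨M - 1, by omega⟩
    simp_all [truncRel]
  tail_of_incr x y z h h' := by simp_all [truncRel]

/-- The `+ 2` in `IsSmall` is what is needed: a prefix of length at most `M - 2`, cut at `M - 1`,
must be all of `y`. -/
theorem eq_tail_of_truncRel_tail {x y : BoundedList M} (h : truncRel M n .tail x y)
    (hx : IsSmall M x.1.tail) : y.1 = x.1.tail := by
  have h1 : (y.1.take (M - 1)).length + 2 ≤ M := by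
    rw [show y.1.take (M - 1) = x.1.tail from h]
    exact hx.1
  rw [List.length_take] at h1
  rw [← show y.1.take (M - 1) = x.1.tail from h, List.take_of_length_le (by omega)]

theorem eq_cons_of_truncRel_tail {x y : BoundedList M} (h : truncRel M n .tail x y)
    (hy : IsSmall M y.1) : x.1.tail = y.1 := by
  rw [← show y.1.take (M - 1) = x.1.tail from h, List.take_of_length_le]
  have := hy.1
  omega

/-- Each conclusion assumes a small evaluation of the compound code. Inverting it gives small
evaluations of the parts, which the premises of the rule turn into equalities of the intermediate
lists; smallness makes the truncated operations exact. -/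
theorem truncRel_codeRules (c : Code) : CodeRules (truncRel M n) c := by
  induction c with
  | zero' =>
    intro x y h l hl
    cases hl with
    | zero' hs =>
      rw [show y.1 = (0 :: x.1).take M from h, List.take_of_length_le]
      have := hs.1
      omega
  | succ =>
    intro x y z w hi hh ht hw l hl
    cases hl with
    | succ hs =>
      have hz : z.1.tail = [] := by
        rw [← show w.1.take (M - 1) = z.1.tail from ht, show w.1 = [] from hw, List.take_nil]
      have h1 := hs.2 (x.1.headI + 1) (by simp)
      rw [show y.1 = min (z.1.headI + 1) M :: z.1.tail from hi, hz,
        ← show x.1.headI = z.1.headI from hh, min_eq_left h1.le]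
  | tail =>
    intro x y ht l hl
    cases hl with
    | tail hs => exact eq_tail_of_truncRel_tail ht hs
  | cons f g hf hg =>
    refine ⟨fun x y z w hy hz ht hh hne l hl => ?_, hf, hg⟩
    cases hl with
    | cons ha hb hs _ =>
      have h1 := hy _ ha
      have h2 := hz _ hb
      subst h1 h2
      have h3 := eq_cons_of_truncRel_tail ht hs
      rw [← h3, ← show w.1.headI = y.1.headI from hh]
      exact (headI_cons_tail hne).symm
  | comp f g hf hg =>
    refine ⟨fun x y z hy hz l hl => ?_, hf, hg⟩
    cases hl with
    | comp ha hb =>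
      have h1 := hy _ ha
      subst h1
      exact hz _ hb
  | case f g hf hg =>
    refine ⟨fun x y z h0 ht hz l hl => ?_, fun x y z hne hi hz l hl => ?_, hf, hg⟩
    · replace h0 : x.1.headI = 0 := h0
      cases hl with
      | case_zero _ hs ha => exact hz _ (by rwa [eq_tail_of_truncRel_tail ht hs])
      | case_succ h1 _ _ => omega
    · replace hi : x.1 = min (y.1.headI + 1) M :: y.1.tail := hi
      have hhd : x.1.headI = min (y.1.headI + 1) M := by rw [hi]; rfl
      have htl : x.1.tail = y.1.tail := by rw [hi]; rfl
      cases hl with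
      | case_zero h0 hs _ =>
        have := hs.1
        omega
      | @case_succ _ _ _ k _ h0 hs ha =>
        -- A head strictly below `M` shows that the increment was not cut off, so it can be undone.
        have h1 := hs.2 x.1.headI (by rw [hi]; simp)
        have hk : k = y.1.headI := by omega
        rw [htl, hk, headI_cons_tail hne] at ha
        exact hz _ ha
  | fix f hf =>
    refine ⟨fun x y z hy h0 ht l hl => ?_, fun x y z w hy h0 ht hw l hl => ?_, hf⟩
    · replace h0 : y.1.headI = 0 := h0
      cases hl with
      | fix_zero ha _ hs =>
        have h1 := hy _ ha
        subst h1
        exact eq_tail_of_truncRel_tail ht hs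
      | fix_succ ha h1 _ _ => exact absurd (hy _ ha ▸ h0) h1
    · replace h0 : y.1.headI ≠ 0 := h0
      cases hl with
      | fix_zero ha h1 _ => exact absurd h1 (hy _ ha ▸ h0)
      | fix_succ ha _ hs hb =>
        have h1 := hy _ ha
        subst h1
        exact hw _ (by rwa [eq_tail_of_truncRel_tail ht hs])

end Truncation

end DataComplexity

/-! ### The evaluation theory of a code on an input -/

namespace DataComplexity

open Turing.ToPartrec (Code)

/-- The clause theory stating that the code `c` does not evaluate on the input to a list with
head `0`. -/
def evalTheory (c : Code) : ClauseTheory where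
  total := [ListRel.push.name, ListRel.incr.name]
  clauses := goalClause [(.start, 0, 0), (.run c, 0, 1), (.zero, 1, 1)] ::
    (listClauses ++ codeClauses c)

/-- The facts describing the input `[n]`: constant `0` is the empty list, and constant `i + 1` is
the list `[i]` for `i ≤ n`. -/
def inputFacts (n : ℕ) : List (ℕ × ℕ × ℕ) :=
  [(ListRel.nil.name, 0, 0), (ListRel.push.name, 0, 1), (ListRel.start.name, n + 1, n + 1)] ++
    (List.range n).map fun i => (ListRel.incr.name, i + 1, i + 2)

theorem evalTheory_isModel_iff {c : Code} {n : ℕ} {D : Type} {R : ℕ → D → D → Prop} {k : ℕ → D} :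
    (evalTheory c).IsModel (inputFacts n) R k ↔
      ((∀ x, ∃ y, R ListRel.push.name x y) ∧ ∀ x, ∃ y, R ListRel.incr.name x y) ∧
      ((∀ x y, R ListRel.start.name x x → R (ListRel.run c).name x y →
        ¬ R ListRel.zero.name y y) ∧ ListRules (fun q => R q.name) ∧
        CodeRules (fun q => R q.name) c) ∧
      R ListRel.nil.name (k 0) (k 0) ∧ R ListRel.push.name (k 0) (k 1) ∧
      R ListRel.start.name (k (n + 1)) (k (n + 1)) ∧
      ∀ i < n, R ListRel.incr.name (k (i + 1)) (k (i + 2)) := by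
  have hcl : SatClauses R (evalTheory c).clauses ↔
      (∀ x y, R ListRel.start.name x x → R (ListRel.run c).name x y →
        ¬ R ListRel.zero.name y y) ∧ ListRules (fun q => R q.name) ∧
        CodeRules (fun q => R q.name) c := by
    rw [evalTheory, satClauses_cons, satClauses_append, satClauses_listClauses,
      satClauses_codeClauses, sat_goalClause]
    refine and_congr_left fun _ => ?_
    simp only [List.forall_mem_cons, List.not_mem_nil, false_imp_iff, implies_true, and_true,
      Matrix.cons_val, not_and]
    exact ⟨fun h x y => h x y x x, fun h x y _ _ => h x y⟩
  rw [← hcl]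
  constructor
  · rintro ⟨h1, h2, h3⟩
    refine ⟨by simpa [evalTheory] using h1, h2, ?_⟩
    simpa [inputFacts] using h3
  · rintro ⟨h1, h2, h3⟩
    exact ⟨by simpa [evalTheory] using h1, h2, by simpa [inputFacts] using h3⟩

theorem not_isModel_of_eval_zero {c : Code} {n : ℕ} (h : [0] ∈ c.eval [n]) {D : Type}
    (R : ℕ → D → D → Prop) (k : ℕ → D) : ¬ (evalTheory c).IsModel (inputFacts n) R k := by
  rw [evalTheory_isModel_iff]
  rintro ⟨⟨hpush, hincr⟩, ⟨hgoal, hlist, hcode⟩, hk0, hk1, hstart, hk⟩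
  have hM : ListModel fun q => R q.name := ⟨hlist, ⟨_, hk0⟩, hpush, hincr⟩
  have hrep : ∀ i ≤ n, Represents (fun q => R q.name) [i] (k (i + 1)) := by
    intro i hi
    induction i with
    | zero => exact .push (.nil hk0) hk1
    | succ i ih => exact .incr (ih (by omega)) (hk i (by omega))
  -- In an arbitrary model no size bound is needed, so the side condition is taken to be trivial.
  obtain ⟨M, hB⟩ := (eventually_bigStep (P := fun _ _ => True)
    (fun _ => Filter.Eventually.of_forall fun _ => trivial) c h).exists
  obtain ⟨z, hz, hrun⟩ := hM.exists_run hcode hB (hrep n le_rfl)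
  exact hgoal _ _ hstart hrun (hM.zero_of_represents hz rfl)

theorem exists_finite_model_of_eval_one {c : Code} {n : ℕ} (h : [1] ∈ c.eval [n]) :
    ∃ (D : Type) (_ : Finite D) (R : ℕ → D → D → Prop) (k : ℕ → D),
      (evalTheory c).IsModel (inputFacts n) R k := by
  -- The bound is large enough for the whole evaluation to stay small and for `[n]` to be a bounded
  -- list.
  obtain ⟨M, hB, hM, hn⟩ := ((eventually_bigStep eventually_isSmall c h).and
    ((Filter.eventually_ge_atTop 2).and (Filter.eventually_gt_atTop n))).exists
  let S := truncRel M n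
  let R : ℕ → BoundedList M → BoundedList M → Prop := fun p x y => ∃ q, q.name = p ∧ S q x y
  have hR : ∀ q : ListRel, R q.name = S q := by
    intro q
    funext x y
    refine propext ⟨?_, fun hq => ⟨q, rfl, hq⟩⟩
    rintro ⟨q', hq', hS⟩
    rwa [ListRel.name_injective hq'] at hS
  let k : ℕ → BoundedList M := fun i => match i with
    | 0 => ⟨[], by simp⟩
    | i + 1 => ⟨[min i M], by simp; omega⟩
  refine ⟨BoundedList M, inferInstance, R, k, evalTheory_isModel_iff.2 ?_⟩
  simp only [hR]
  refine ⟨⟨fun x => ?_, fun x => ?_⟩, ⟨fun x y hx hxy hy => ?_, truncRel_listRules hM,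
    truncRel_codeRules c⟩, rfl, ?_, ?_, fun i _ => ?_⟩
  · refine ⟨⟨(0 :: x.1).take M, by simp, fun a ha => ?_⟩, rfl⟩
    rcases List.mem_cons.1 (List.mem_of_mem_take ha) with rfl | ha
    · exact Nat.zero_le _
    · exact x.2.2 a ha
  · refine ⟨⟨min (x.1.headI + 1) M :: x.1.tail, ?_, fun a ha => ?_⟩, rfl⟩
    · have := x.2.1
      simp
      omega
    · rcases List.mem_cons.1 ha with rfl | ha
      · exact min_le_right _ _
      · exact x.2.2 a (List.mem_of_mem_tail ha)
  · have h1 := hxy [1] (by rw [show x.1 = [n] from hx]; exact hB)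
    have h2 : y.1.headI = 0 := hy
    rw [h1] at h2
    exact absurd h2 (by simp)
  · obtain ⟨M, rfl⟩ : ∃ m, M = m + 1 := ⟨M - 1, by omega⟩
    simp [S, truncRel, k]
  · simp [S, truncRel, k, hn.le]
  · simp [S, truncRel, k]
    omega

/-! ### Computability of the reduction -/

theorem primrec_atom_rel : Primrec fun a : ℕ × List ℕ => (Atom.rel a.1 a.2 : Atom ℕ) :=
  (Primrec.of_equiv_symm (e := Atom.equivSum ℕ)).comp Primrec.sumInl

theorem primrec_symAtom {α : Type} [Primcodable α] (q : Sym) {f g : α → ℕ} (hf : Primrec f)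
    (hg : Primrec g) : Primrec fun a => ((true, q.atom (f a) (g a)) : Literal) :=
  (Primrec.const true).pair <| primrec_atom_rel.comp <| (Primrec.const q.name).pair <|
    Primrec.list_cons.comp hf <| Primrec.list_cons.comp hg <| Primrec.const []

theorem computable_data (T : ClauseTheory) : Computable fun n => T.data (inputFacts n) := by
  have hfact : ∀ (p : ℕ) {f g : ℕ → ℕ}, Primrec f → Primrec g →
      Primrec fun n => T.factLits (p, f n, g n) := by
    intro p f g hf hg
    have hf' := Primrec.nat_add.comp hf (Primrec.const T.clauses.length)
    have hg' := Primrec.nat_add.comp hg (Primrec.const T.clauses.length)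
    exact Primrec.list_cons.comp (primrec_symAtom (.lit true p) hf' hg') <|
      Primrec.list_cons.comp (primrec_symAtom .core hf' hf') <|
      Primrec.list_cons.comp (primrec_symAtom .core hg' hg') <| Primrec.const []
  have hincr : Primrec fun n => (List.range n).flatMap fun i =>
      T.factLits (ListRel.incr.name, i + 1, i + 2) :=
    Primrec.list_flatMap Primrec.list_range
      ((hfact _ Primrec.succ (Primrec.succ.comp Primrec.succ)).comp Primrec.snd).to₂
  have hstart := hfact ListRel.start.name Primrec.succ Primrec.succ
  refine ((Primrec.list_append.comp (Primrec.const (T.baseData ++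
    T.factLits (ListRel.nil.name, 0, 0) ++ T.factLits (ListRel.push.name, 0, 1)))
    (Primrec.list_append.comp hstart hincr)).of_eq fun n => ?_).to_comp
  simp [ClauseTheory.data, inputFacts, List.flatMap_map]

/-! ### Recursive inseparability and the conclusion -/

/-- There is a code for which the inputs with output `0` and those with output `1` are recursively
inseparable. -/
theorem exists_inseparable_code : ∃ c : Code, ∀ p : ℕ → Prop, ComputablePred p →
    (∀ n, [0] ∈ c.eval [n] → p n) → ¬ ∀ n, [1] ∈ c.eval [n] → ¬ p n := by
  have hf : Partrec fun n : ℕ => (Denumerable.ofNat Nat.Partrec.Code n).eval n :=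
    Nat.Partrec.Code.eval_part.comp (Computable.ofNat _) Computable.id
  obtain ⟨c, hc⟩ := Turing.ToPartrec.Code.exists_code (Nat.Partrec'.part_iff₁.2 hf)
  have hc' : ∀ n m, m ∈ (Denumerable.ofNat Nat.Partrec.Code n).eval n → [m] ∈ c.eval [n] := by
    intro n m hm
    have := hc (n ::ᵥ .nil)
    simp only [List.Vector.head_cons] at this
    rw [show [n] = (n ::ᵥ List.Vector.nil).1 from rfl, this]
    exact (Part.mem_map_iff _).2 ⟨m, hm, rfl⟩
  refine ⟨c, fun p ⟨_, hp⟩ h0 h1 => ?_⟩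
  have hg : Computable fun n => cond (decide (p n)) 1 0 :=
    Computable.cond hp (Computable.const 1) (Computable.const 0)
  -- Diagonalization: `c` runs the `n`-th program on `n`, and `e` computes the characteristic
  -- function of the supposed separator `p`. Run on its own index, it puts that index on the wrong
  -- side.
  obtain ⟨e, he⟩ := Nat.Partrec.Code.exists_code.1 (Partrec.nat_iff.1 hg.partrec)
  have hmem := hc' (Encodable.encode e) (cond (decide (p (Encodable.encode e))) 1 0) (by
    rw [Denumerable.ofNat_encode, he]
    exact Part.mem_some _)
  by_cases hpe : p (Encodable.encode e)
  · exact h1 _ (by simpa [hpe] using hmem) hpe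
  · exact hpe (h0 _ (by simpa [hpe] using hmem))

end DataComplexity

-- One sentence and one query serve both problems: outputs `0` give entailment over all models,
-- hence over finite ones, and outputs `1` give finite countermodels. Each answer set thus separates
-- the two output classes.
open DataComplexity in
theorem undecidable_queryAnswering :
    ∃ φ : Formula (Fin 2), φ.IsL2minus ∧ φ.IsSentence ∧ ∃ ψ : ConjQuery 0,
      ¬ ComputablePred (QueryAnswering φ ψ) ∧ ¬ ComputablePred (FiniteQueryAnswering φ ψ) := by
  obtain ⟨c, hc⟩ := exists_inseparable_code
  let T := evalTheory c
  have hinst : Computable fun n => (T.data (inputFacts n), (List.Vector.nil : List.Vector ℕ 0)) :=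
    (computable_data T).pair (Computable.const _)
  have hpos : ∀ n, [0] ∈ c.eval [n] →
      QueryAnswering T.sentence T.query (T.data (inputFacts n), List.Vector.nil) := fun n hn =>
    T.queryAnswering_of_no_model (fun _ => not_isModel_of_eval_zero hn) _
  have hneg : ∀ n, [1] ∈ c.eval [n] →
      ¬ FiniteQueryAnswering T.sentence T.query (T.data (inputFacts n), List.Vector.nil) := by
    intro n hn
    obtain ⟨D, _, R, k, hk⟩ := exists_finite_model_of_eval_one hn
    exact T.not_finiteQueryAnswering_of_model hk _
  have hfin : ∀ i, QueryAnswering T.sentence T.query i →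
      FiniteQueryAnswering T.sentence T.query i := fun i h D _ I hI => h D I hI
  refine ⟨T.sentence, T.sentence_isL2minus, T.sentence_isSentence, T.query, ?_, ?_⟩
  · rintro ⟨_, h⟩
    exact hc _ ⟨fun _ => inferInstance, h.comp hinst⟩ hpos fun n hn hq => hneg n hn (hfin _ hq)
  · rintro ⟨_, h⟩
    exact hc _ ⟨fun _ => inferInstance, h.comp hinst⟩ (fun n hn => hfin _ (hpos n hn)) hneg

theorem theorem3 :
    (∃ φ : DataComplexity.Formula (Fin 2), φ.IsL2minus ∧ φ.IsSentence ∧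
      ∃ (m : ℕ) (ψ : DataComplexity.ConjQuery m),
        ¬ ComputablePred (DataComplexity.QueryAnswering φ ψ)) ∧
    (∃ φ : DataComplexity.Formula (Fin 2), φ.IsL2minus ∧ φ.IsSentence ∧
      ∃ (m : ℕ) (ψ : DataComplexity.ConjQuery m),
        ¬ ComputablePred (DataComplexity.FiniteQueryAnswering φ ψ)) := by
  obtain ⟨φ, h1, h2, ψ, h3, h4⟩ := undecidable_queryAnswering
  exact ⟨⟨φ, h1, h2, 0, ψ, h3⟩, ⟨φ, h1, h2, 0, ψ, h4⟩⟩
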